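/- **Setting.** Fix $J$ and $K$. Respondents $i=1,2,\dots$ have latent classes $\xi_i\in\{1,\dots,K\}$ and binary responses $Y_{i1},\dots,Y_{iJ}\in\{0,1\}$. The pairs $(\xi_i,(Y_{ij})_j)$ are independent over $i$, $P(\xi_i=k)=\nu^*_k$, $P(Y_{ij}=1\mid\xi_i=k)=\beta^*_{jk}$, and $Y_{i1},\dots,Y_{iJ}$ are conditionally independent given $\xi_i$. For each sample size $N$, let $(\hat\nu,\hat{\mathbf B})$, a function of the first $N$ respondents' responses, be a maximizer of the marginal log-likelihood $$l(\nu,\mathbf B)=\sum_{i=1}^N\log\Big(\sum_{k=1}^K\nu_k\prod_{j=1}^J\beta_{jk}^{Y_{ij}}(1-\beta_{jk})^{1-Y_{ij}}\Big)$$ over all probability vectors $\nu$ and all $\mathbf B\in[0,1]^{J\times K}$ (unrestricted MLE, with class labels aligned with the truth). Let $$\hat\gamma_{ik}=\frac{\hat\nu_k\prod_j\hat\beta_{jk}^{Y_{ij}}(1-\hat\beta_{jk})^{1-Y_{ij}}}{\sum_h\hat\nu_h\prod_j\hat\beta_{jh}^{Y_{ij}}(1-\hat\beta_{jh})^{1-Y_{ij}}},\qquad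 Q_j(\beta)=\sum_{i=1}^N\sum_{k=1}^K\hat\gamma_{ik}\big(Y_{ij}\log\beta_k+(1-Y_{ij})\log(1-\beta_k)\big),\quad \beta\in[0,1]^K,$$ with $\log 0=-\infty$ and $0\cdot(-\infty)=0$. **Stepwise search for item $j$.** For an ordered partition $\mathcal C=(C_1,\dots,C_s)$ of $\{1,\dots,K\}$ let $\Theta(\mathcal C)$ be the set of $\beta\in[0,1]^K$ that are constant on each block and satisfy $\beta_k<\beta_{k'}$ whenever $k\in C_l$, $k'\in C_{l'}$, $l<l'$. Let $\pi$ be a permutation with $\hat\beta_{j\pi(1)}\le\dots\le\hat\beta_{j\pi(K)}$. Start with $\tilde\beta_j^{(K)}=\hat\beta_j$ and $\mathcal C^{(K)}=(\{\pi(1)\},\dots,\{\pi(K)\})$. For $s=K,K-1,\dots,2$ and each $b=1,\dots,s-1$, merge the adjacent blocks $b$ and $b+1$ of $\mathcal C^{(s)}$ and maximize $Q_j$ over the corresponding $\Theta$ (over its closure if the maximum over $\Theta$ is not attained, as may happen when $\hat\beta_j$ has ties); among these $s-1$ candidates, let $\tilde\beta_j^{(s-1)}$ be one with the largest value of $Q_j$,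 and $\mathcal C^{(s-1)}$ its ordered partition. Ties in any choice may be broken arbitrarily, as a function of the data. For a constant $\rho>0$ put $$\mathrm{EBIC}_j(m)=-2Q_j(\tilde\beta_j^{(m)})+m\log N+2m\log\rho ,$$ let $\tilde m_j$ be a minimizer of $\mathrm{EBIC}_j$ over $\{1,\dots,K\}$, and let $\tilde\beta_j=\tilde\beta_j^{(\tilde m_j)}$ be the refined estimate. Let $m_j^*$ be the number of distinct values among $\beta^*_{j1},\dots,\beta^*_{jK}$. **Theorem.** Assume that 1. $\|\hat\nu-\nu^*\|=O_p(N^{-1/2})$ and $\|\hat{\mathbf B}-\mathbf B^*\|_F=O_p(N^{-1/2})$; 2. $0<\beta^*_{jk}<1$ and $\nu^*_k>0$ for all $j,k$; 3. $\rho$ does not depend on $N$. Then for each item $j$, as $N\to\infty$: $P(\tilde m_j=m_j^*)\to1$; $P(\tilde\beta_{jg}=\tilde\beta_{jh})\to1$ for all $g,h$ with $\beta^*_{jg}=\beta^*_{jh}$; and $P(\tilde\beta_{jg}\ne\tilde\beta_{jh})\to1$ for all $g,h$ with $\beta^*_{jg}\ne\beta^*_{jh}$. -/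

import Mathlib

open MeasureTheory Filter Topology

noncomputable section

namespace LCA

/-- An `N × J` binary response matrix: `y i j` is the response of respondent `i` to item `j`. -/
abbrev Data (N J : ℕ) : Type := Fin N → Fin J → Fin 2

/-- Logarithm of a nonnegative real with the convention `log 0 = -∞`. -/
def elog (x : ℝ) : EReal := if 0 < x then ((Real.log x : ℝ) : EReal) else ⊥

/-- The Bernoulli probability `β ^ y * (1 - β) ^ (1 - y)` of a binary response `y`. -/
def bern (β : ℝ) (y : Fin 2) : ℝ := β ^ (y : ℕ) * (1 - β) ^ (1 - (y : ℕ))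

/-- The binary latent class model with `K` classes and `J` items, with class probabilities `ν` and
item response probabilities `B j k`. `ξ i` is the latent class of respondent `i`, and `Y i j` the
response of respondent `i` to item `j`. Respondents are i.i.d.; given the class of a respondent, the
responses are independent and depend on the class through `B` only. -/
structure IsLatentClassModel {Ω : Type*} [MeasurableSpace Ω] (μ : Measure Ω) {J K : ℕ}
    (ν : Fin K → ℝ) (B : Fin J → Fin K → ℝ)
    (ξ : ℕ → Ω → Fin K) (Y : ℕ → Fin J → Ω → Fin 2) : Prop where
  measurable_class : ∀ i, Measurable (ξ i)
  measurable_response : ∀ i j, Measurable (Y i j)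
  indep_respondents :
    ProbabilityTheory.iIndepFun (fun i ω => (ξ i ω, fun j => Y i j ω)) μ
  class_prob : ∀ i k, μ.real {ω | ξ i ω = k} = ν k
  response_prob : ∀ i j k, 0 < ν k →
    (ProbabilityTheory.cond μ {ω | ξ i ω = k}).real {ω | Y i j ω = 1} = B j k
  local_indep : ∀ i k, 0 < ν k →
    ProbabilityTheory.iIndepFun (fun j => Y i j) (ProbabilityTheory.cond μ {ω | ξ i ω = k})

/-- The response matrix of the first `N` respondents. -/
def sample {Ω : Type*} {J : ℕ} (Y : ℕ → Fin J → Ω → Fin 2) (N : ℕ) (ω : Ω) : Data N J :=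
  fun i j => Y i j ω

/-- The parameter space: `ν` is a probability vector and every `B j k` lies in `[0, 1]`. -/
def paramSpace (J K : ℕ) : Set ((Fin K → ℝ) × (Fin J → Fin K → ℝ)) :=
  {θ | (∀ k, 0 ≤ θ.1 k) ∧ ∑ k, θ.1 k = 1 ∧ ∀ j k, θ.2 j k ∈ Set.Icc (0 : ℝ) 1}

/-- The marginal log-likelihood. -/
def logLik {N J K : ℕ} (y : Data N J) (θ : (Fin K → ℝ) × (Fin J → Fin K → ℝ)) : EReal :=
  ∑ i, elog (∑ k, θ.1 k * ∏ j, bern (θ.2 j k) (y i j))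

/-- `(ν, B)` is an unrestricted maximum likelihood estimate for the data `y`. -/
def IsMLE {N J K : ℕ} (y : Data N J) (ν : Fin K → ℝ) (B : Fin J → Fin K → ℝ) : Prop :=
  (ν, B) ∈ paramSpace J K ∧ IsMaxOn (logLik y) (paramSpace J K) (ν, B)

/-- The posterior probability that respondent `i` belongs to class `k` under `(ν, B)`. -/
def posterior {N J K : ℕ} (y : Data N J) (ν : Fin K → ℝ) (B : Fin J → Fin K → ℝ)
    (i : Fin N) (k : Fin K) : ℝ :=
  (ν k * ∏ j, bern (B j k) (y i j)) / ∑ h, ν h * ∏ j, bern (B j h) (y i j)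

/-- The item-specific pseudo-likelihood `Q_j(β ; Γ)`. -/
def pseudoLik {N J K : ℕ} (y : Data N J) (Γ : Fin N → Fin K → ℝ) (j : Fin J)
    (β : Fin K → ℝ) : EReal :=
  ∑ i, ∑ k, ((Γ i k : ℝ) : EReal) *
    (((y i j : ℕ) : EReal) * elog (β k) + ((1 - (y i j : ℕ) : ℕ) : EReal) * elog (1 - β k))

/-- An ordered partition of the classes into blocks `C_0, C_1, …` is encoded by the map `c` sending
a class to the index of its block, `C_l = {k | c k = l}`. This is the constrained parameter
space `Θ(C)`: constant on blocks, strictly increasing from block to block. -/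
def Theta {K : ℕ} (c : Fin K → ℕ) : Set (Fin K → ℝ) :=
  {β | (∀ k, β k ∈ Set.Icc (0 : ℝ) 1) ∧ (∀ k k', c k = c k' → β k = β k') ∧
    ∀ k k', c k < c k' → β k < β k'}

/-- Merge the adjacent blocks `C_b` and `C_{b+1}`, keeping the order of the blocks. -/
def mergeBlocks {K : ℕ} (c : Fin K → ℕ) (b : ℕ) : Fin K → ℕ :=
  fun k => if c k ≤ b then c k else c k - 1

/-- `β` maximizes `Q` over `T`. If the maximum over `T` is not attained, `β` is required to maximize
`Q` over the closure of `T` instead. (For `T = Theta c` in the stepwise search this second case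
only serves to keep the search defined when the initial estimate has ties.) -/
def IsArgmax {K : ℕ} (Q : (Fin K → ℝ) → EReal) (T : Set (Fin K → ℝ)) (β : Fin K → ℝ) : Prop :=
  (β ∈ T ∧ IsMaxOn Q T β) ∨
    ((¬ ∃ β' ∈ T, IsMaxOn Q T β') ∧ β ∈ closure T ∧ IsMaxOn Q (closure T) β)

/-- A run of the stepwise search for an item with pseudo-likelihood `Q` and initial estimate `βhat`.
Ties in any of the choices may be broken arbitrarily. Levels are `s = K, K - 1, …, 1`, and
the candidate merges from level `s + 1` to level `s` are indexed by `b = 0, …, s - 1`. -/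
structure StepwiseRun {K : ℕ} (Q : (Fin K → ℝ) → EReal) (βhat : Fin K → ℝ) where
  /-- the permutation sorting the initial estimate -/
  perm : Equiv.Perm (Fin K)
  /-- `part s` is the ordered partition into `s` blocks -/
  part : ℕ → Fin K → ℕ
  /-- `cand s b` is the constrained solution for the `b`-th candidate partition into `s` blocks -/
  cand : ℕ → ℕ → Fin K → ℝ
  /-- `sel s` is the index of the selected candidate partition into `s` blocks -/
  sel : ℕ → ℕ
  /-- `est s` is the `s`-level candidate solution -/
  est : ℕ → Fin K → ℝ
  perm_sorts : Monotone (βhat ∘ perm)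
  est_top : est K = βhat
  part_top : ∀ k, part K k = (perm.symm k : ℕ)
  cand_isArgmax : ∀ s, 1 ≤ s → s < K → ∀ b < s,
    IsArgmax Q (Theta (mergeBlocks (part (s + 1)) b)) (cand s b)
  sel_lt : ∀ s, 1 ≤ s → s < K → sel s < s
  sel_max : ∀ s, 1 ≤ s → s < K → ∀ b < s, Q (cand s b) ≤ Q (cand s (sel s))
  est_step : ∀ s, 1 ≤ s → s < K → est s = cand s (sel s)
  part_step : ∀ s, 1 ≤ s → s < K → part s = mergeBlocks (part (s + 1)) (sel s)

/-- The extended BIC of the `m`-level candidate with pseudo-likelihood value `q`. -/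
def EBIC (N : ℕ) (ρ : ℝ) (m : ℕ) (q : EReal) : EReal :=
  ((-2 : ℝ) : EReal) * q + ((m * Real.log N + 2 * m * Real.log ρ : ℝ) : EReal)

/-- `m` minimizes the EBIC over the candidate solutions `est 1, …, est K`. -/
def IsEBICChoice {K : ℕ} (N : ℕ) (ρ : ℝ) (Q : (Fin K → ℝ) → EReal) (est : ℕ → Fin K → ℝ)
    (m : ℕ) : Prop :=
  m ∈ Set.Icc 1 K ∧ ∀ m' ∈ Set.Icc 1 K, EBIC N ρ m (Q (est m)) ≤ EBIC N ρ m' (Q (est m'))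

/-- The number of distinct entries of `β`. -/
def numLevels {K : ℕ} (β : Fin K → ℝ) : ℕ := (Finset.univ.image β).card

/-- `X_N = O_p(a_N)`. -/
def IsBigOp {Ω : Type*} [MeasurableSpace Ω] (μ : Measure Ω) (X : ℕ → Ω → ℝ) (a : ℕ → ℝ) : Prop :=
  ∀ ε : ℝ, 0 < ε → ∃ M : ℝ, ∃ N₀ : ℕ, ∀ N ≥ N₀, μ.real {ω | M * a N < |X N ω|} ≤ ε

end LCA

end

/-! At an interior maximizer of the marginal likelihood, the score equations say that class `k` has
total posterior weight `N * ν k` and weighted response sum `N * ν k * B j k` (`IsMLE.sum_posterior`,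
`IsMLE.sum_posterior_mul_response`). Hence `Q_j` is exactly `N` times a weighted Bernoulli
cross-entropy, maximal at the estimate itself, and the rest is deterministic once the estimates lie
within `M / √N` of the truth. A vector equating two different true levels loses order `N`
(`pseudoLik_le`), while every sorted partition that separates the true levels admits a vector losing
only `O(1)` (`bernoulli_entropy_sub_le`).

As long as there are more blocks than levels, some adjacent merge mixes no levels
(`exists_refines_mergeBlocks`); the best merge is at least as good, so it cannot mix levels either.
The search thus passes through the true partition. In the EBIC, fewer blocks cost order `N` against
a penalty of order `log N`; more blocks gain `O(1)` against at least one extra `log N`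
(`StepwiseRun.selects`). Root-N consistency makes the good event likely
(`tendsto_measure_one_of_isBigOp`). -/

namespace LCA

/-! ### The stepwise search -/

section Search

variable {K : ℕ}

/-- The ordered partition `c` does not put classes with different values of `β` into one block. -/
def Refines (c : Fin K → ℕ) (β : Fin K → ℝ) : Prop := ∀ k k', c k = c k' → β k = β k'

/-- The blocks of the ordered partition `c` are sorted by the values of `β`. -/
def Sorts (c : Fin K → ℕ) (β : Fin K → ℝ) : Prop := ∀ k k', c k < c k' → β k ≤ β k'

theorem lt_of_mergeBlocks_lt {c : Fin K → ℕ} {b : ℕ} {k k' : Fin K}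
    (h : mergeBlocks c b k < mergeBlocks c b k') : c k < c k' := by
  unfold mergeBlocks at h
  split_ifs at h <;> omega

theorem Sorts.mergeBlocks {c : Fin K → ℕ} {β : Fin K → ℝ} (h : Sorts c β) (b : ℕ) :
    Sorts (mergeBlocks c b) β :=
  fun _ _ hk => h _ _ (lt_of_mergeBlocks_lt hk)

theorem mergeBlocks_lt {c : Fin K → ℕ} {b s : ℕ} (hc : ∀ k, c k < s + 1) (hb : b < s)
    (k : Fin K) : mergeBlocks c b k < s := by
  have := hc k
  unfold LCA.mergeBlocks
  split_ifs <;> omega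

theorem Refines.exists_factor {c : Fin K → ℕ} {β : Fin K → ℝ} (h : Refines c β) :
    ∃ e : ℕ → ℝ, ∀ k, β k = e (c k) := by
  obtain ⟨e, he⟩ := (Function.factorsThrough_iff β).1 fun k k' => h k k'
  exact ⟨e, congrFun he⟩

theorem image_subset_image_range {c : Fin K → ℕ} {β : Fin K → ℝ} {s : ℕ} {e : ℕ → ℝ}
    (he : ∀ k, β k = e (c k)) (hc : ∀ k, c k < s) :
    Finset.univ.image β ⊆ (Finset.range s).image e := by
  intro x hx
  obtain ⟨k, -, rfl⟩ := Finset.mem_image.1 hx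
  rw [he]
  exact Finset.mem_image_of_mem _ (Finset.mem_range.2 (hc k))

theorem Refines.numLevels_le {c : Fin K → ℕ} {β : Fin K → ℝ} {s : ℕ} (h : Refines c β)
    (hc : ∀ k, c k < s) : numLevels β ≤ s := by
  obtain ⟨e, he⟩ := h.exists_factor
  exact ((Finset.card_le_card (image_subset_image_range he hc)).trans
    Finset.card_image_le).trans_eq (Finset.card_range s)

/-- The factor map through the blocks sends `numLevels β` indices onto at least as many values, so
it is injective. -/
theorem Refines.eq_of_eq {c : Fin K → ℕ} {β : Fin K → ℝ} (h : Refines c β)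
    (hc : ∀ k, c k < numLevels β) {g g' : Fin K} (hg : β g = β g') : c g = c g' := by
  obtain ⟨e, he⟩ := h.exists_factor
  have hcard : ((Finset.range (numLevels β)).image e).card = (Finset.range (numLevels β)).card :=
    le_antisymm Finset.card_image_le
      ((Finset.card_range _).trans_le (Finset.card_le_card (image_subset_image_range he hc)))
  refine Finset.card_image_iff.1 hcard ?_ ?_ (by rw [← he, ← he, hg]) <;> simpa using hc _

/-- A sorted refinement with more blocks than levels has a merge that is still a refinement. -/
theorem exists_refines_mergeBlocks {c : Fin K → ℕ} {β : Fin K → ℝ} {s : ℕ} (hs : 1 ≤ s)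
    (hsort : Sorts c β) (href : Refines c β) (hlev : numLevels β ≤ s) :
    ∃ b < s, Refines (mergeBlocks c b) β := by
  classical
  by_contra! hcon
  -- If every merge fails, each adjacent pair of blocks carries a strict increase of `β`, and
  -- representatives give `s + 1` distinct levels.
  have hpair : ∀ b, b < s → ∃ k k', c k = b ∧ c k' = b + 1 ∧ β k < β k' := by
    intro b hb
    have := hcon b hb
    unfold Refines at this
    push Not at this
    obtain ⟨k, k', hkk, hne⟩ := this
    have hne' : c k ≠ c k' := fun h => hne (href _ _ h)
    unfold mergeBlocks at hkk
    rcases lt_or_gt_of_ne hne' with hlt | hlt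
    · refine ⟨k, k', ?_, ?_, lt_of_le_of_ne (hsort _ _ hlt) hne⟩ <;>
      · split_ifs at hkk <;> omega
    · refine ⟨k', k, ?_, ?_, lt_of_le_of_ne (hsort _ _ hlt) (Ne.symm hne)⟩ <;>
      · split_ifs at hkk <;> omega
  have hrep : ∀ l : Fin (s + 1), ∃ k, c k = l := by
    intro l
    rcases Nat.lt_or_ge (l : ℕ) s with hl | hl
    · obtain ⟨k, _, hk, _⟩ := hpair l hl
      exact ⟨k, hk⟩
    -- The last block `s` occurs only as the upper member of the pair `s - 1`, which exists because
    -- `1 ≤ s`.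
    · obtain ⟨_, k, _, hk, _⟩ := hpair (s - 1) (by omega)
      exact ⟨k, by have := l.2; omega⟩
  choose r hr using hrep
  have hmono : StrictMono fun l => β (r l) := by
    rw [Fin.strictMono_iff_lt_succ]
    intro i
    obtain ⟨k, k', hk, hk', hlt⟩ := hpair i i.2
    have h1 : β (r i.castSucc) = β k := href _ _ (by rw [hr, hk]; rfl)
    have h2 : β (r i.succ) = β k' := href _ _ (by rw [hr, hk']; simp)
    simpa only [h1, h2] using hlt
  have : s + 1 ≤ numLevels β := by
    rw [← Fintype.card_fin (s + 1), ← Finset.card_univ]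
    exact Finset.card_le_card_of_injOn (fun l => β (r l)) (fun l _ => by simp)
      (hmono.injective.injOn)
  omega

/-- Strict order between blocks is lost in the limit, but the box and constancy on blocks are closed
conditions. Only these are used of candidates in the closure. -/
theorem closure_Theta_subset (c : Fin K → ℕ) :
    closure (Theta c) ⊆
      {β | (∀ k, β k ∈ Set.Icc (0 : ℝ) 1) ∧ ∀ k k', c k = c k' → β k = β k'} := by
  refine closure_minimal (fun β h => ⟨h.1, h.2.1⟩) ?_
  simp only [Set.ofPred_and, Set.ofPred_forall]
  refine (isClosed_iInter fun k => isClosed_Icc.preimage (continuous_apply k)).inter ?_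
  exact isClosed_iInter fun k => isClosed_iInter fun k' => isClosed_iInter fun _ =>
    isClosed_eq (continuous_apply k) (continuous_apply k')

theorem IsArgmax.mem_closure {Q : (Fin K → ℝ) → EReal} {T : Set (Fin K → ℝ)} {β : Fin K → ℝ}
    (h : IsArgmax Q T β) : β ∈ closure T :=
  h.elim (fun h => subset_closure h.1) fun h => h.2.1

theorem IsArgmax.le {Q : (Fin K → ℝ) → EReal} {T : Set (Fin K → ℝ)} {β β' : Fin K → ℝ}
    (h : IsArgmax Q T β) (hβ' : β' ∈ T) : Q β' ≤ Q β :=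
  h.elim (fun h => h.2 hβ') fun h => h.2.2 (subset_closure hβ')

namespace StepwiseRun

variable {Q : (Fin K → ℝ) → EReal} {b : Fin K → ℝ} (R : StepwiseRun Q b)

theorem part_lt {s : ℕ} (hs : 1 ≤ s) (hsK : s ≤ K) (k : Fin K) : R.part s k < s := by
  induction hsK using Nat.decreasingInduction generalizing k with
  | self => rw [R.part_top]; exact (R.perm.symm k).2
  | of_succ t ht ih =>
    rw [R.part_step t hs ht]
    exact mergeBlocks_lt (fun k => ih (by omega) k) (R.sel_lt t hs ht) k

theorem part_sorts {s : ℕ} (hs : 1 ≤ s) (hsK : s ≤ K) : Sorts (R.part s) b := by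
  induction hsK using Nat.decreasingInduction with
  | self =>
    intro k k' h
    rw [R.part_top, R.part_top] at h
    simpa using R.perm_sorts (show R.perm.symm k ≤ R.perm.symm k' from h.le)
  | of_succ t ht ih =>
    rw [R.part_step t hs ht]
    exact (ih (by omega)).mergeBlocks _

theorem est_mem_closure {s : ℕ} (hs : 1 ≤ s) (hsK : s < K) :
    R.est s ∈ closure (Theta (R.part s)) := by
  rw [R.est_step s hs hsK, R.part_step s hs hsK]
  exact (R.cand_isArgmax s hs hsK _ (R.sel_lt s hs hsK)).mem_closure

theorem est_mem_Icc (hb : ∀ k, b k ∈ Set.Icc (0 : ℝ) 1) {s : ℕ} (hs : 1 ≤ s) (hsK : s ≤ K) :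
    ∀ k, R.est s k ∈ Set.Icc (0 : ℝ) 1 := by
  rcases hsK.lt_or_eq with h | rfl
  · exact (closure_Theta_subset _ (R.est_mem_closure hs h)).1
  · rw [R.est_top]; exact hb

theorem est_eq_of_part_eq {s : ℕ} (hs : 1 ≤ s) (hsK : s ≤ K) {k k' : Fin K}
    (h : R.part s k = R.part s k') : R.est s k = R.est s k' := by
  rcases hsK.lt_or_eq with hlt | rfl
  · exact (closure_Theta_subset _ (R.est_mem_closure hs hlt)).2 _ _ h
  · rw [R.part_top, R.part_top] at h
    rw [R.perm.symm.injective (Fin.ext h)]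

end StepwiseRun

end Search

/-! ### Deterministic selection by the EBIC -/

theorem EBIC_le_EBIC {N : ℕ} {ρ : ℝ} {m m' : ℕ} {q q' : EReal} {u v : ℝ} (hu : q ≤ (u : EReal))
    (hv : (v : EReal) ≤ q') (h : EBIC N ρ m q ≤ EBIC N ρ m' q') :
    -2 * u + m * (Real.log N + 2 * Real.log ρ) ≤ -2 * v + m' * (Real.log N + 2 * Real.log ρ) := by
  have key : ∀ x y : EReal, x ≤ y → ((-2 : ℝ) : EReal) * y ≤ ((-2 : ℝ) : EReal) * x := by
    intro x y hxy
    rw [EReal.coe_neg, EReal.neg_mul, EReal.neg_mul, EReal.neg_le_neg_iff]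
    exact mul_le_mul_of_nonneg_left hxy (by exact_mod_cast (by norm_num : (0 : ℝ) ≤ 2))
  unfold EBIC at h
  have h1 := (add_le_add_left (key _ _ hu) _).trans (h.trans (add_le_add_left (key _ _ hv) _))
  rw [← EReal.coe_mul, ← EReal.coe_mul, ← EReal.coe_add, ← EReal.coe_add,
    EReal.coe_le_coe_iff] at h1
  linarith

/-- Selection consistency of the stepwise search with the EBIC, for an objective which is at most
`q` everywhere, at most `q - H` at points that equate different levels of `βs`, and at least `q - C`
somewhere in `Θ(c)`, for every sorted refinement `c` of the levels of `βs`. -/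
theorem StepwiseRun.selects {K N : ℕ} {Q : (Fin K → ℝ) → EReal} {b βs : Fin K → ℝ}
    (R : StepwiseRun Q b) {ρ q C H : ℝ} (hC : 0 ≤ C)
    (hb : ∀ k, b k ∈ Set.Icc (0 : ℝ) 1) (hQb : (q : EReal) ≤ Q b)
    (hsort : ∀ k k', b k ≤ b k' → βs k ≤ βs k')
    (hle : ∀ β : Fin K → ℝ, (∀ k, β k ∈ Set.Icc (0 : ℝ) 1) → Q β ≤ (q : EReal))
    (hmix : ∀ β : Fin K → ℝ, (∀ k, β k ∈ Set.Icc (0 : ℝ) 1) → ∀ g h, β g = β h → βs g ≠ βs h →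
      Q β ≤ ((q - H : ℝ) : EReal))
    (hex : ∀ c : Fin K → ℕ, (∀ k, c k < K) → Sorts c βs → Refines c βs →
      ∃ β ∈ Theta c, ((q - C : ℝ) : EReal) ≤ Q β)
    (hCH : 2 * C + K * |Real.log N + 2 * Real.log ρ| < 2 * H)
    (hlog : 2 * C < Real.log N + 2 * Real.log ρ)
    {m : ℕ} (hm : IsEBICChoice N ρ Q R.est m) :
    m = numLevels βs ∧ ∀ g h, R.est m g = R.est m h ↔ βs g = βs h := by
  obtain ⟨⟨hm1, hmK⟩, hmin⟩ := hm
  have hCH' : C < H := by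
    have : 0 ≤ (K : ℝ) * |Real.log N + 2 * Real.log ρ| := by positivity
    linarith
  have hlevK : numLevels βs ≤ K := by
    simpa [numLevels] using Finset.card_image_le (s := Finset.univ) (f := βs)
  have hlev1 : 1 ≤ numLevels βs :=
    Finset.card_pos.2 ⟨βs ⟨0, by omega⟩, Finset.mem_image_of_mem _ (Finset.mem_univ _)⟩
  have hsorts : ∀ s, 1 ≤ s → s ≤ K → Sorts (R.part s) βs := fun s h1 h2 k k' h =>
    hsort _ _ (R.part_sorts h1 h2 k k' h)
  -- A loss of at most `C` is too small to equate different levels, which costs at least `H > C`.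
  have hno : ∀ s, 1 ≤ s → s ≤ K → ((q - C : ℝ) : EReal) ≤ Q (R.est s) →
      ∀ g h, R.est s g = R.est s h → βs g = βs h := by
    intro s h1 h2 hQ g h hgh
    by_contra hne
    have := hQ.trans (hmix _ (R.est_mem_Icc hb h1 h2) g h hgh hne)
    rw [EReal.coe_le_coe_iff] at this
    linarith
  -- Invariant down to `numLevels βs` blocks: some level-preserving merge loses at most `C`, so the
  -- selected solution does too, and by `hno` its blocks mix no levels.
  have hgood : ∀ s, s ≤ K → numLevels βs ≤ s →
      ((q - C : ℝ) : EReal) ≤ Q (R.est s) ∧ Refines (R.part s) βs := by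
    intro s hsK
    induction hsK using Nat.decreasingInduction with
    | self =>
      refine fun _ => ⟨?_, ?_⟩
      · rw [R.est_top]
        exact le_trans (EReal.coe_le_coe_iff.2 (by linarith)) hQb
      · intro k k' h
        rw [R.part_top, R.part_top] at h
        rw [R.perm.symm.injective (Fin.ext h)]
    | of_succ t ht ih =>
      intro hlt
      have ht1 : 1 ≤ t := by omega
      obtain ⟨hQ, href⟩ := ih (by omega)
      obtain ⟨a, hat, ha⟩ := exists_refines_mergeBlocks ht1
        (hsorts (t + 1) (by omega) ht) href hlt
      have hlt' := mergeBlocks_lt (R.part_lt (s := t + 1) (by omega) ht) hat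
      obtain ⟨β, hβ, hQβ⟩ := hex _ (fun k => (hlt' k).trans ht)
        ((hsorts (t + 1) (by omega) ht).mergeBlocks a) ha
      have hQ' : ((q - C : ℝ) : EReal) ≤ Q (R.est t) := by
        rw [R.est_step t ht1 ht]
        exact hQβ.trans (((R.cand_isArgmax t ht1 ht a hat).le hβ).trans (R.sel_max t ht1 ht a hat))
      exact ⟨hQ', fun k k' h =>
        hno t ht1 ht.le hQ' k k' (R.est_eq_of_part_eq ht1 ht.le h)⟩
  have hstar := hgood _ hlevK le_rfl
  have hmeq : m = numLevels βs := by
    have hE := hmin _ ⟨hlev1, hlevK⟩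
    rcases lt_trichotomy m (numLevels βs) with hlt | heq | hgt
    -- Too few blocks mix two levels, and the penalty saved, at most `K` units, cannot repay the
    -- loss `H`.
    · exfalso
      have hnot : ¬ Refines (R.part m) βs := fun h => by
        have := h.numLevels_le (R.part_lt hm1 hmK)
        omega
      unfold Refines at hnot
      push Not at hnot
      obtain ⟨k, k', hkk, hne⟩ := hnot
      have hu := hmix _ (R.est_mem_Icc hb hm1 hmK) k k' (R.est_eq_of_part_eq hm1 hmK hkk) hne
      have h1 := EBIC_le_EBIC hu hstar.1 hE
      have h2 : ((numLevels βs : ℝ) - m) * (Real.log N + 2 * Real.log ρ) ≤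
          K * |Real.log N + 2 * Real.log ρ| := by
        have h3 : (m : ℝ) < numLevels βs := by exact_mod_cast hlt
        have h4 : (numLevels βs : ℝ) ≤ K := by exact_mod_cast hlevK
        have h5 : (0 : ℝ) ≤ m := by positivity
        calc _ ≤ ((numLevels βs : ℝ) - m) * |Real.log N + 2 * Real.log ρ| :=
              mul_le_mul_of_nonneg_left (le_abs_self _) (by linarith)
          _ ≤ _ := mul_le_mul_of_nonneg_right (by linarith) (abs_nonneg _)
      linarith
    · exact heq
    -- Extra blocks raise `Q` by at most `C` but cost at least one more penalty unit, which exceeds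
    -- `2 * C` by `hlog`.
    · exfalso
      have h1 := EBIC_le_EBIC (hle _ (R.est_mem_Icc hb hm1 hmK)) hstar.1 hE
      have h3 : (numLevels βs : ℝ) + 1 ≤ m := by exact_mod_cast hgt
      nlinarith
  refine ⟨hmeq, fun g h => ⟨?_, fun hgh => ?_⟩⟩
  · subst hmeq
    exact hno _ hm1 hmK hstar.1 g h
  · subst hmeq
    exact R.est_eq_of_part_eq hm1 hmK (hstar.2.eq_of_eq (R.part_lt hm1 hmK) hgh)

end LCA
namespace LCA

/-! ### Score equations of the maximum likelihood estimate -/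

theorem elog_of_pos {x : ℝ} (hx : 0 < x) : elog x = (Real.log x : EReal) := if_pos hx

theorem coe_finset_sum {ι : Type*} (s : Finset ι) (f : ι → ℝ) :
    ((∑ i ∈ s, f i : ℝ) : EReal) = ∑ i ∈ s, (f i : EReal) :=
  map_sum (⟨⟨Real.toEReal, EReal.coe_zero⟩, EReal.coe_add⟩ : ℝ →+ EReal) f s

theorem sum_div_eq_zero_of_isLocalMax {ι : Type*} [Fintype ι] {a d : ι → ℝ} (ha : ∀ i, 0 < a i)
    (h : IsLocalMax (fun t : ℝ => ∑ i, Real.log (a i + t * d i)) 0) : ∑ i, d i / a i = 0 := by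
  refine h.hasDerivAt_eq_zero (HasDerivAt.fun_sum fun i _ => ?_)
  have h1 : HasDerivAt (fun t : ℝ => a i + t * d i) (d i) 0 := by
    simpa using ((hasDerivAt_id (0 : ℝ)).mul_const (d i)).const_add (a i)
  simpa using h1.log (by simpa using (ha i).ne')

theorem bern_pos {β : ℝ} (h0 : 0 < β) (h1 : β < 1) (y : Fin 2) : 0 < bern β y := by
  have : 0 < 1 - β := by linarith
  unfold bern; positivity

section MLE

variable {N J K : ℕ} {y : Data N J} {ν : Fin K → ℝ} {B : Fin J → Fin K → ℝ}

/-- The marginal likelihood of respondent `i`. -/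
def lik (y : Data N J) (θ : (Fin K → ℝ) × (Fin J → Fin K → ℝ)) (i : Fin N) : ℝ :=
  ∑ k, θ.1 k * ∏ j, bern (θ.2 j k) (y i j)

theorem IsMLE.nonempty (h : IsMLE y ν B) : Nonempty (Fin K) := by
  by_contra hK
  rw [not_nonempty_iff] at hK
  simpa using h.1.2.1

theorem lik_pos [Nonempty (Fin K)] (hν : ∀ k, 0 < ν k) (hB : ∀ j k, 0 < B j k ∧ B j k < 1)
    (i : Fin N) : 0 < lik y (ν, B) i :=
  Finset.sum_pos (fun k _ => mul_pos (hν k)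
    (Finset.prod_pos fun j _ => bern_pos (hB j k).1 (hB j k).2 _)) Finset.univ_nonempty

theorem posterior_nonneg (hν : ∀ k, 0 < ν k) (hB : ∀ j k, 0 < B j k ∧ B j k < 1)
    (i : Fin N) (k : Fin K) : 0 ≤ posterior y ν B i k := by
  have hp : ∀ k, 0 < ν k * ∏ j, bern (B j k) (y i j) := fun k =>
    mul_pos (hν k) (Finset.prod_pos fun j _ => bern_pos (hB j k).1 (hB j k).2 _)
  exact div_nonneg (hp k).le (Finset.sum_nonneg fun h _ => (hp h).le)

theorem logLik_eq_coe {θ : (Fin K → ℝ) × (Fin J → Fin K → ℝ)} (h : ∀ i, 0 < lik y θ i) :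
    logLik y θ = ((∑ i, Real.log (lik y θ i) : ℝ) : EReal) := by
  unfold logLik
  rw [coe_finset_sum]
  exact Finset.sum_congr rfl fun i _ => elog_of_pos (h i)

/-- The derivative of the log-likelihood at an MLE vanishes along any line on which the likelihood
contributions are affine. -/
theorem IsMLE.sum_div_lik_eq_zero (h : IsMLE y ν B) (hpos : ∀ i, 0 < lik y (ν, B) i)
    (θ : ℝ → (Fin K → ℝ) × (Fin J → Fin K → ℝ)) (d : Fin N → ℝ)
    (hθ : ∀ᶠ t in 𝓝 0, θ t ∈ paramSpace J K)
    (hd : ∀ t i, lik y (θ t) i = lik y (ν, B) i + t * d i) :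
    ∑ i, d i / lik y (ν, B) i = 0 := by
  refine sum_div_eq_zero_of_isLocalMax hpos ?_
  have hev : ∀ᶠ t in 𝓝 (0 : ℝ), ∀ i, 0 < lik y (ν, B) i + t * d i := by
    rw [eventually_all]
    intro i
    have hc : Tendsto (fun t : ℝ => lik y (ν, B) i + t * d i) (𝓝 0) (𝓝 (lik y (ν, B) i)) := by
      have : Continuous fun t : ℝ => lik y (ν, B) i + t * d i := by fun_prop
      simpa using this.tendsto 0
    exact hc.eventually (lt_mem_nhds (hpos i))
  filter_upwards [hθ, hev] with t ht hp
  have := h.2 ht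
  simp only [Set.mem_ofPred_eq] at this
  rw [logLik_eq_coe hpos, logLik_eq_coe (fun i => by rw [hd]; exact hp i),
    EReal.coe_le_coe_iff] at this
  simpa [hd] using this

/-- Moving `ν` towards the `k`-th vertex keeps the total mass and makes each likelihood affine;
positivity of `ν` allows both signs of the step, so the derivative vanishes. -/
theorem IsMLE.sum_posterior (h : IsMLE y ν B) (hν : ∀ k, 0 < ν k)
    (hB : ∀ j k, 0 < B j k ∧ B j k < 1) (k : Fin K) :
    ∑ i, posterior y ν B i k = N * ν k := by
  have := h.nonempty
  have hpos := lik_pos (y := y) hν hB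
  have key := h.sum_div_lik_eq_zero hpos
    (fun t => (fun h => ν h + t * ((if h = k then 1 else 0) - ν h), B))
    (fun i => ∏ j, bern (B j k) (y i j) - lik y (ν, B) i) ?_ ?_
  · simp only [sub_div, Finset.sum_sub_distrib, div_self (hpos _).ne'] at key
    simp only [Finset.sum_const, Finset.card_univ, Fintype.card_fin, nsmul_eq_mul, mul_one] at key
    rw [← sub_eq_zero.1 key, Finset.sum_mul]
    refine Finset.sum_congr rfl fun i _ => ?_
    rw [div_mul_eq_mul_div, mul_comm]
    rfl
  · have hev : ∀ᶠ t in 𝓝 (0 : ℝ), ∀ h, 0 < ν h + t * ((if h = k then 1 else 0) - ν h) := by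
      rw [eventually_all]
      intro h
      have hc : Continuous fun t : ℝ => ν h + t * ((if h = k then 1 else 0) - ν h) := by fun_prop
      have := hc.tendsto 0
      simp only [zero_mul, add_zero] at this
      exact this.eventually (lt_mem_nhds (hν h))
    filter_upwards [hev] with t ht
    refine ⟨fun h => (ht h).le, ?_, h.1.2.2⟩
    simp [Finset.sum_add_distrib, ← Finset.mul_sum, h.1.2.1]
  · intro t i
    simp only [lik, add_mul, Finset.sum_add_distrib, mul_assoc, ← Finset.mul_sum, sub_mul,
      Finset.sum_sub_distrib, ite_mul, one_mul, zero_mul, Finset.sum_ite_eq', Finset.mem_univ,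
      if_true]

theorem bern_add (β t : ℝ) (y : Fin 2) :
    bern (β + t) y = bern β y + t * ((y : ℕ) - (1 - (y : ℕ) : ℕ) : ℝ) := by
  fin_cases y <;> simp [bern]
  ring

/-- Changing the single entry `B j k` alters one factor of one product, so the likelihood is again
affine. The posterior-weighted residual is `B j k * (1 - B j k)` times the resulting score. -/
theorem IsMLE.sum_posterior_mul_response (h : IsMLE y ν B) (hν : ∀ k, 0 < ν k)
    (hB : ∀ j k, 0 < B j k ∧ B j k < 1) (j : Fin J) (k : Fin K) :
    ∑ i, posterior y ν B i k * ((y i j : ℕ) : ℝ) = N * ν k * B j k := by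
  have := h.nonempty
  have hpos := lik_pos (y := y) hν hB
  have hB0 := (hB j k).1
  have hB1 : 0 < 1 - B j k := by linarith [(hB j k).2]
  let σ : Fin N → ℝ := fun i => ((y i j : ℕ) : ℝ) - ((1 - (y i j : ℕ) : ℕ) : ℝ)
  let P : Fin N → ℝ := fun i => ∏ j' ∈ Finset.univ.erase j, bern (B j' k) (y i j')
  let B' : ℝ → Fin J → Fin K → ℝ := fun t j' k' => B j' k' + if j' = j ∧ k' = k then t else 0
  have hprod : ∀ t i, ∏ j', bern (B' t j' k) (y i j') = bern (B j k + t) (y i j) * P i := by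
    intro t i
    rw [← Finset.mul_prod_erase _ _ (Finset.mem_univ j)]
    congr 1
    · simp [B']
    · exact Finset.prod_congr rfl fun j' hj' => by simp [B', Finset.ne_of_mem_erase hj']
  have hprod' : ∀ i, ∏ j', bern (B j' k) (y i j') = bern (B j k) (y i j) * P i := fun i =>
    (Finset.mul_prod_erase _ _ (Finset.mem_univ j)).symm
  have key := h.sum_div_lik_eq_zero hpos (fun t => (ν, B' t)) (fun i => ν k * (σ i * P i)) ?_ ?_
  · have hterm : ∀ i, posterior y ν B i k * (((y i j : ℕ) : ℝ) - B j k) =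
        (B j k * (1 - B j k)) * (ν k * (σ i * P i) / lik y (ν, B) i) := by
      intro i
      have : posterior y ν B i k = ν k * (bern (B j k) (y i j) * P i) / lik y (ν, B) i := by
        rw [← hprod']; rfl
      rw [this, div_mul_eq_mul_div, mul_div_assoc']
      congr 1
      have hy : bern (B j k) (y i j) * (((y i j : ℕ) : ℝ) - B j k) =
          B j k * (1 - B j k) * σ i := by
        simp only [σ, bern]
        generalize y i j = z
        fin_cases z <;> simp <;> ring
      linear_combination ν k * P i * hy
    have hsum : ∑ i, posterior y ν B i k * (((y i j : ℕ) : ℝ) - B j k) = 0 := by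
      rw [Finset.sum_congr rfl fun i _ => hterm i, ← Finset.mul_sum, key, mul_zero]
    simp only [mul_sub, Finset.sum_sub_distrib, ← Finset.sum_mul] at hsum
    rw [h.sum_posterior hν hB] at hsum
    linarith
  · have hev : ∀ᶠ t in 𝓝 (0 : ℝ), B j k + t ∈ Set.Ioo (0 : ℝ) 1 := by
      have hc : Continuous fun t : ℝ => B j k + t := by fun_prop
      have := hc.tendsto 0
      rw [add_zero] at this
      exact this.eventually (Ioo_mem_nhds (hB j k).1 (hB j k).2)
    filter_upwards [hev] with t ht
    refine ⟨h.1.1, h.1.2.1, fun j' k' => ?_⟩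
    by_cases hjk : j' = j ∧ k' = k
    · obtain ⟨rfl, rfl⟩ := hjk
      simpa [B'] using ⟨ht.1.le, ht.2.le⟩
    · simpa [B', hjk] using h.1.2.2 j' k'
  · intro t i
    unfold lik
    rw [← Finset.add_sum_erase _ _ (Finset.mem_univ k),
      ← Finset.add_sum_erase (a := k) _ _ (Finset.mem_univ k)]
    simp only [hprod, hprod', bern_add]
    have : ∀ x ∈ Finset.univ.erase k, ν x * ∏ j', bern (B' t j' x) (y i j') =
        ν x * ∏ j', bern (B j' x) (y i j') := fun x hx => by
      simp [B', Finset.ne_of_mem_erase hx]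
    rw [Finset.sum_congr rfl this]
    simp only [σ]
    ring

end MLE

/-! ### Bounds for the pseudo-likelihood -/

/-- Tangent line bound for the logarithm on `[0, 1]`, with a quadratic term. -/
theorem elog_le {x b : ℝ} (hx : x ∈ Set.Icc (0 : ℝ) 1) (hb0 : 0 < b) (hb1 : b < 1) :
    elog x ≤ ((Real.log b + (x - b) / b - (x - b) ^ 2 / 4 : ℝ) : EReal) := by
  unfold elog
  split_ifs with h
  · rw [EReal.coe_le_coe_iff]
    -- With square roots, `log t ≤ t - 1` at `t = p / q` leaves the surplus `(p - q)^2 / q^2`, which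
    -- dominates `(p^2 - q^2)^2 / 4` because `q ≤ 1` and `p + q ≤ 2`.
    obtain ⟨p, hp, rfl⟩ : ∃ p, 0 < p ∧ x = p ^ 2 := ⟨√x, Real.sqrt_pos.2 h, (Real.sq_sqrt h.le).symm⟩
    obtain ⟨q, hq, rfl⟩ : ∃ q, 0 < q ∧ b = q ^ 2 :=
      ⟨√b, Real.sqrt_pos.2 hb0, (Real.sq_sqrt hb0.le).symm⟩
    have hp1 : p ≤ 1 := by nlinarith [hx.2]
    have hq1 : q ≤ 1 := by nlinarith
    have h1 : Real.log (p ^ 2) - Real.log (q ^ 2) ≤ 2 * (p / q - 1) := by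
      rw [Real.log_pow, Real.log_pow, ← mul_sub, ← Real.log_div hp.ne' hq.ne']
      have := Real.log_le_sub_one_of_pos (div_pos hp hq)
      push_cast; linarith
    have h2 : (p ^ 2 - q ^ 2) / q ^ 2 = 2 * (p / q - 1) + (p - q) ^ 2 / q ^ 2 := by
      field_simp; ring
    have h3 : (p ^ 2 - q ^ 2) ^ 2 / 4 ≤ (p - q) ^ 2 / q ^ 2 := by
      have h4 : (p ^ 2 - q ^ 2) ^ 2 / 4 ≤ (p - q) ^ 2 := by
        have : (p + q) ^ 2 ≤ 4 := by nlinarith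
        nlinarith [mul_le_mul_of_nonneg_left this (sq_nonneg (p - q))]
      refine h4.trans (le_div_self (sq_nonneg _) (by positivity) (by nlinarith))
    linarith
  · exact bot_le

section PseudoLik

variable {N J K : ℕ} {y : Data N J} {Γ : Fin N → Fin K → ℝ} {j : Fin J} {w b : Fin K → ℝ}

/-- The summand is affine in the response, so only two posterior moments of each class enter. -/
theorem sum_weighted_eq (hW : ∀ k, ∑ i, Γ i k = N * w k)
    (hS : ∀ k, ∑ i, Γ i k * ((y i j : ℕ) : ℝ) = N * w k * b k) (u v : Fin K → ℝ) :
    ∑ i, ∑ k, Γ i k * (((y i j : ℕ) : ℝ) * u k + (1 - ((y i j : ℕ) : ℝ)) * v k) =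
      N * ∑ k, w k * (b k * u k + (1 - b k) * v k) := by
  rw [Finset.sum_comm, Finset.mul_sum]
  refine Finset.sum_congr rfl fun k _ => ?_
  have : ∀ i, Γ i k * (((y i j : ℕ) : ℝ) * u k + (1 - ((y i j : ℕ) : ℝ)) * v k) =
      Γ i k * ((y i j : ℕ) : ℝ) * (u k - v k) + Γ i k * v k := fun i => by ring
  rw [Finset.sum_congr rfl fun i _ => this i, Finset.sum_add_distrib, ← Finset.sum_mul,
    ← Finset.sum_mul, hW, hS]
  ring

/-- Since `0 * ⊥ = 0` in `EReal`, the inactive logarithm drops out even when it is `⊥`. -/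
theorem response_term_eq (z : Fin 2) (p q : EReal) :
    ((z : ℕ) : EReal) * p + ((1 - (z : ℕ) : ℕ) : EReal) * q = if z = 0 then q else p := by
  fin_cases z <;> simp

theorem response_term_eq_real (z : Fin 2) (p q : ℝ) :
    ((z : ℕ) : ℝ) * p + (1 - ((z : ℕ) : ℝ)) * q = if z = 0 then q else p := by
  fin_cases z <;> simp

theorem pseudoLik_eq_coe {β : Fin K → ℝ} (hβ : ∀ k, 0 < β k ∧ β k < 1)
    (hW : ∀ k, ∑ i, Γ i k = N * w k)
    (hS : ∀ k, ∑ i, Γ i k * ((y i j : ℕ) : ℝ) = N * w k * b k) :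
    pseudoLik y Γ j β = ((N * ∑ k, w k * (b k * Real.log (β k) +
      (1 - b k) * Real.log (1 - β k)) : ℝ) : EReal) := by
  rw [← sum_weighted_eq hW hS]
  unfold pseudoLik
  simp only [coe_finset_sum, EReal.coe_mul, response_term_eq, response_term_eq_real]
  refine Finset.sum_congr rfl fun i _ => Finset.sum_congr rfl fun k _ => ?_
  rw [elog_of_pos (hβ k).1, elog_of_pos (by linarith [(hβ k).2])]
  split_ifs <;> rfl

/-- Apply `elog_le` to both logarithms: under the weights `b` and `1 - b` the linear terms cancel
and the quadratic ones add up to `(β - b)^2 / 4`. -/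
theorem pseudoLik_le {β : Fin K → ℝ} (hΓ : ∀ i k, 0 ≤ Γ i k)
    (hb : ∀ k, 0 < b k ∧ b k < 1) (hβ : ∀ k, β k ∈ Set.Icc (0 : ℝ) 1)
    (hW : ∀ k, ∑ i, Γ i k = N * w k)
    (hS : ∀ k, ∑ i, Γ i k * ((y i j : ℕ) : ℝ) = N * w k * b k) :
    pseudoLik y Γ j β ≤ ((N * ∑ k, w k * (b k * Real.log (b k) +
      (1 - b k) * Real.log (1 - b k)) - N * ∑ k, w k * ((β k - b k) ^ 2 / 4) : ℝ) : EReal) := by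
  have hle : pseudoLik y Γ j β ≤ ((∑ i, ∑ k, Γ i k * (((y i j : ℕ) : ℝ) *
      (Real.log (b k) + (β k - b k) / b k - (β k - b k) ^ 2 / 4) + (1 - ((y i j : ℕ) : ℝ)) *
      (Real.log (1 - b k) + ((1 - β k) - (1 - b k)) / (1 - b k) -
        ((1 - β k) - (1 - b k)) ^ 2 / 4)) : ℝ) : EReal) := by
    unfold pseudoLik
    simp only [coe_finset_sum, EReal.coe_mul, response_term_eq, response_term_eq_real]
    refine Finset.sum_le_sum fun i _ => Finset.sum_le_sum fun k _ => ?_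
    refine mul_le_mul_of_nonneg_left ?_ (EReal.coe_nonneg.2 (hΓ i k))
    split_ifs
    · exact elog_le ⟨by linarith [(hβ k).2], by linarith [(hβ k).1]⟩ (by linarith [(hb k).2])
        (by linarith [(hb k).1])
    · exact elog_le (hβ k) (hb k).1 (hb k).2
  refine hle.trans (EReal.coe_le_coe_iff.2 (le_of_eq ?_))
  rw [sum_weighted_eq hW hS, ← mul_sub, ← Finset.sum_sub_distrib]
  congr 1
  refine Finset.sum_congr rfl fun k _ => ?_
  have h0 := (hb k).1.ne'
  have h1 : 1 - b k ≠ 0 := by linarith [(hb k).2]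
  field_simp
  ring

/-- Bound of the Kullback-Leibler divergence of Bernoulli laws by the chi-square divergence. -/
theorem bernoulli_entropy_sub_le {b β : ℝ} (hb : 0 < b ∧ b < 1) (hβ : 0 < β ∧ β < 1) :
    b * Real.log b + (1 - b) * Real.log (1 - b) - (b - β) ^ 2 / (β * (1 - β)) ≤
      b * Real.log β + (1 - b) * Real.log (1 - β) := by
  have hb1 : 0 < 1 - b := by linarith
  have hβ1 : 0 < 1 - β := by linarith
  have h1 := Real.log_le_sub_one_of_pos (div_pos hb.1 hβ.1)
  have h2 := Real.log_le_sub_one_of_pos (div_pos hb1 hβ1)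
  rw [Real.log_div hb.1.ne' hβ.1.ne'] at h1
  rw [Real.log_div hb1.ne' hβ1.ne'] at h2
  have h3 : (b - β) ^ 2 / (β * (1 - β)) =
      b * (b / β - 1) + (1 - b) * ((1 - b) / (1 - β) - 1) := by
    have := hβ.1.ne'
    have := hβ1.ne'
    field_simp
    ring
  rw [h3]
  have := mul_le_mul_of_nonneg_left h1 hb.1.le
  have := mul_le_mul_of_nonneg_left h2 hb1.le
  linarith

end PseudoLik

end LCA
namespace LCA

/-! ### Selection for estimates close to the truth -/

/-- Here `c` is the margin of the truth and `r` the estimation error. Per respondent, mixing levels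
loses `c / 2 * (c / 4)^2 / 4`; a good vector loses `16 * r^2 / c^2`, the chi-square bound at
distance `2 * r`. -/
theorem selects_of_close {N J K : ℕ} {y : Data N J} {ν νs : Fin K → ℝ}
    {B Bs : Fin J → Fin K → ℝ} {j : Fin J} {c r ρ : ℝ} (hN : 0 < N) (hc : 0 < c) (hr : 0 < r)
    (hrc : r ≤ c / 8) (hνs : ∀ k, c ≤ νs k) (hBs : ∀ j k, c ≤ Bs j k ∧ Bs j k ≤ 1 - c)
    (hsep : ∀ k k', Bs j k ≠ Bs j k' → c ≤ |Bs j k - Bs j k'|)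
    (hν : ∀ k, |ν k - νs k| ≤ r) (hB : ∀ j k, |B j k - Bs j k| ≤ r)
    (hmle : IsMLE y ν B) (R : StepwiseRun (pseudoLik y (posterior y ν B) j) (B j))
    (hCH : 2 * (N * (16 * r ^ 2 / c ^ 2)) + K * |Real.log N + 2 * Real.log ρ| <
      2 * (N * (c ^ 3 / 128)))
    (hlog : 2 * (N * (16 * r ^ 2 / c ^ 2)) < Real.log N + 2 * Real.log ρ)
    {m : ℕ} (hm : IsEBICChoice N ρ (pseudoLik y (posterior y ν B) j) R.est m) :
    m = numLevels (Bs j) ∧ ∀ g h, R.est m g = R.est m h ↔ Bs j g = Bs j h := by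
  have hN' : (0 : ℝ) < N := by exact_mod_cast hN
  have hν2 : ∀ k, c / 2 ≤ ν k := fun k => by
    have := (abs_le.1 (hν k)).1
    linarith [hνs k]
  have hν0 : ∀ k, 0 < ν k := fun k => by linarith [hν2 k]
  have hB01 : ∀ j k, 0 < B j k ∧ B j k < 1 := fun j k => by
    have := abs_le.1 (hB j k)
    constructor <;> linarith [hBs j k]
  have hΓ := posterior_nonneg (y := y) hν0 hB01
  have hW := hmle.sum_posterior hν0 hB01
  have hS := hmle.sum_posterior_mul_response hν0 hB01 j
  have hsum : ∑ k, ν k = 1 := hmle.1.2.1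
  refine R.selects (C := N * (16 * r ^ 2 / c ^ 2)) (H := N * (c ^ 3 / 128))
    (q := N * ∑ k, ν k * (B j k * Real.log (B j k) + (1 - B j k) * Real.log (1 - B j k)))
    (by positivity) (fun k => ⟨(hB01 j k).1.le, (hB01 j k).2.le⟩)
    (pseudoLik_eq_coe (hB01 j) hW hS).ge ?_ ?_ ?_ ?_ hCH hlog hm
  · intro k k' hkk
    by_contra! hlt
    have h1 := hsep k k' hlt.ne'
    rw [abs_of_pos (sub_pos.2 hlt)] at h1
    have h2 := abs_le.1 (hB j k)
    have h3 := abs_le.1 (hB j k')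
    linarith
  · intro β hβ
    refine (pseudoLik_le hΓ (hB01 j) hβ hW hS).trans (EReal.coe_le_coe_iff.2 ?_)
    have : 0 ≤ ∑ k, ν k * ((β k - B j k) ^ 2 / 4) :=
      Finset.sum_nonneg fun k _ => mul_nonneg (hν0 k).le (by positivity)
    have := mul_nonneg hN'.le this
    linarith
  · intro β hβ g h hgh hne
    refine (pseudoLik_le hΓ (hB01 j) hβ hW hS).trans (EReal.coe_le_coe_iff.2 ?_)
    refine sub_le_sub_left (mul_le_mul_of_nonneg_left ?_ hN'.le) _
    -- The two estimates stay `3 * c / 4` apart, so a common value misses one of them by at least `c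
    -- / 4`.
    obtain ⟨k, hk⟩ : ∃ k, c / 4 ≤ |β k - B j k| := by
      by_contra! hcon
      have h1 := abs_lt.1 (hcon g)
      have h2 := abs_lt.1 (hcon h)
      have h3 := abs_le.1 (hB j g)
      have h4 := abs_le.1 (hB j h)
      rcases le_abs.1 (hsep g h hne) with h5 | h5 <;> linarith
    calc c ^ 3 / 128 = c / 2 * ((c / 4) ^ 2 / 4) := by ring
      _ ≤ ν k * ((β k - B j k) ^ 2 / 4) := by
        refine mul_le_mul (hν2 k) ?_ (by positivity) (hν0 k).le
        rw [← sq_abs (β k - B j k)]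
        gcongr
      _ ≤ _ := Finset.single_le_sum (f := fun k => ν k * ((β k - B j k) ^ 2 / 4))
        (fun k _ => mul_nonneg (hν0 k).le (by positivity)) (Finset.mem_univ k)
  · intro p hp hsort href
    -- A tilt of at most `r` strictly orders blocks that share a true level, as `Theta` demands.
    let β : Fin K → ℝ := fun k => Bs j k + r / K * p k
    have hβr : ∀ k, Bs j k ≤ β k ∧ β k ≤ Bs j k + r := fun k => by
      have hK : (0 : ℝ) < K := by exact_mod_cast (Nat.zero_le _).trans_lt (hp k)
      have h1 : (p k : ℝ) ≤ K := by exact_mod_cast (hp k).le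
      have h2 : r / K * p k ≤ r := by
        rw [div_mul_eq_mul_div, div_le_iff₀ hK]
        exact mul_le_mul_of_nonneg_left h1 hr.le
      have h3 : 0 ≤ r / K * p k := by positivity
      exact ⟨by simpa [β] using h3, by simpa [β] using h2⟩
    have hβ2 : ∀ k, c / 2 ≤ β k ∧ c / 2 ≤ 1 - β k := fun k => by
      constructor <;> linarith [hβr k, hBs j k]
    have hβ01 : ∀ k, 0 < β k ∧ β k < 1 := fun k => by
      constructor <;> linarith [hβ2 k]
    refine ⟨β, ⟨fun k => ⟨(hβ01 k).1.le, (hβ01 k).2.le⟩, fun k k' h => ?_, fun k k' h => ?_⟩, ?_⟩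
    · simp only [β, h, href k k' h]
    · have hK : (0 : ℝ) < K := by exact_mod_cast (Nat.zero_le _).trans_lt (hp k)
      have h1 : (p k : ℝ) < p k' := by exact_mod_cast h
      exact add_lt_add_of_le_of_lt (hsort k k' h) (mul_lt_mul_of_pos_left h1 (by positivity))
    · rw [pseudoLik_eq_coe hβ01 hW hS, EReal.coe_le_coe_iff, ← mul_sub]
      refine mul_le_mul_of_nonneg_left ?_ hN'.le
      have hconst : ∑ k, ν k * (16 * r ^ 2 / c ^ 2) = 16 * r ^ 2 / c ^ 2 := by
        rw [← Finset.sum_mul, hsum, one_mul]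
      rw [← hconst, ← Finset.sum_sub_distrib]
      refine Finset.sum_le_sum fun k _ => ?_
      rw [← mul_sub]
      refine mul_le_mul_of_nonneg_left ?_ (hν0 k).le
      refine le_trans ?_ (bernoulli_entropy_sub_le (hB01 j k) (hβ01 k))
      refine sub_le_sub_left ?_ _
      calc (B j k - β k) ^ 2 / (β k * (1 - β k)) ≤ (2 * r) ^ 2 / (c / 2 * (c / 2)) := by
            refine div_le_div₀ (by positivity) ?_ (by positivity)
              (mul_le_mul (hβ2 k).1 (hβ2 k).2 (by positivity) (hβ01 k).1.le)
            have := abs_le.1 (hB j k)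
            exact sq_le_sq' (by linarith [hβr k]) (by linarith [hβr k])
        _ = 16 * r ^ 2 / c ^ 2 := by field_simp; norm_num

/-! ### Margins, rates and probabilities -/

theorem exists_pos_le {ι : Type*} [Finite ι] {f : ι → ℝ} (hf : ∀ i, 0 < f i) :
    ∃ c > 0, ∀ i, c ≤ f i := by
  rcases isEmpty_or_nonempty ι with h | h
  · exact ⟨1, one_pos, h.elim⟩
  · obtain ⟨i, hi⟩ := Finite.exists_min f
    exact ⟨f i, hf i, hi⟩

/-- An interior parameter is bounded away from the boundary, and its levels from each other. -/
theorem exists_margin {J K : ℕ} {νs : Fin K → ℝ} {Bs : Fin J → Fin K → ℝ}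
    (hν : ∀ k, 0 < νs k) (hB : ∀ j k, 0 < Bs j k ∧ Bs j k < 1) :
    ∃ c > 0, (∀ k, c ≤ νs k) ∧ (∀ j k, c ≤ Bs j k ∧ Bs j k ≤ 1 - c) ∧
      ∀ j k k', Bs j k ≠ Bs j k' → c ≤ |Bs j k - Bs j k'| := by
  obtain ⟨c₁, h₁, hc₁⟩ := exists_pos_le hν
  obtain ⟨c₂, h₂, hc₂⟩ := exists_pos_le (f := fun p : Fin J × Fin K => Bs p.1 p.2)
    fun p => (hB p.1 p.2).1
  obtain ⟨c₃, h₃, hc₃⟩ := exists_pos_le (f := fun p : Fin J × Fin K => 1 - Bs p.1 p.2)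
    fun p => sub_pos.2 (hB p.1 p.2).2
  obtain ⟨c₄, h₄, hc₄⟩ := exists_pos_le
    (f := fun p : {p : Fin J × Fin K × Fin K // Bs p.1 p.2.1 ≠ Bs p.1 p.2.2} =>
      |Bs p.1.1 p.1.2.1 - Bs p.1.1 p.1.2.2|) fun p => abs_pos.2 (sub_ne_zero.2 p.2)
  refine ⟨min (min c₁ c₂) (min c₃ c₄), by positivity, fun k => ?_, fun j k => ⟨?_, ?_⟩,
    fun j k k' h => ?_⟩
  · exact ((min_le_left _ _).trans (min_le_left _ _)).trans (hc₁ k)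
  · exact ((min_le_left _ _).trans (min_le_right _ _)).trans (hc₂ (j, k))
  · have := ((min_le_right (min c₁ c₂) _).trans (min_le_left c₃ c₄)).trans (hc₃ (j, k))
    simp only at this
    linarith
  · exact ((min_le_right _ _).trans (min_le_right _ _)).trans (hc₄ ⟨(j, k, k'), h⟩)

/-- The penalty dominates a constant, and is dominated by any linear function of `N`. -/
theorem eventually_penalty (C H L κ : ℝ) (hH : 0 < H) :
    ∀ᶠ N : ℕ in atTop, C + κ * |Real.log N + L| < N * H ∧ C < Real.log N + L := by
  have hlogN : Tendsto (fun N : ℕ => Real.log N) atTop atTop :=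
    Real.tendsto_log_atTop.comp tendsto_natCast_atTop_atTop
  have hconst : ∀ a : ℝ, (fun _ : ℝ => a) =o[atTop] (id : ℝ → ℝ) := fun a =>
    Asymptotics.isLittleO_const_id_atTop a
  have ho : (fun x : ℝ => C + κ * |Real.log x + L|) =o[atTop] (id : ℝ → ℝ) :=
    (hconst C).add ((Real.isLittleO_log_id_atTop.add (hconst L)).norm_left.const_mul_left κ)
  have ho' := tendsto_natCast_atTop_atTop (R := ℝ) |>.eventually (ho.def (half_pos hH))
  filter_upwards [ho', eventually_gt_atTop 0,
    (tendsto_atTop_add_const_right _ L hlogN).eventually_gt_atTop C] with N h1 h2 h3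
  refine ⟨?_, h3⟩
  have h2' : (0 : ℝ) < N := by exact_mod_cast h2
  have h4 := (le_abs_self _).trans h1
  simp only [id, Real.norm_eq_abs, Nat.abs_cast] at h4
  nlinarith

/-- The event fails only if one of two bounds fails, each with probability at most `(1 - x) / 3`.
Monotonicity and subadditivity suffice, so `A N` need not be measurable. -/
theorem tendsto_measure_one_of_isBigOp {Ω : Type*} [MeasurableSpace Ω] {μ : Measure Ω}
    [IsProbabilityMeasure μ] {X X' : ℕ → Ω → ℝ} {a : ℕ → ℝ} (ha : ∀ N, 0 ≤ a N)
    (hX : IsBigOp μ X a) (hX' : IsBigOp μ X' a) {A : ℕ → Set Ω}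
    (h : ∀ M > 0, ∀ᶠ N in atTop, ∀ ω, |X N ω| ≤ M * a N → |X' N ω| ≤ M * a N → ω ∈ A N) :
    Tendsto (fun N => μ (A N)) atTop (𝓝 1) := by
  rw [← ENNReal.tendsto_toReal_iff (fun N => measure_ne_top μ _) ENNReal.one_ne_top,
    ENNReal.toReal_one]
  refine tendsto_order.2 ⟨fun x hx => ?_, fun x hx => Eventually.of_forall fun N =>
    (measureReal_le_one (μ := μ)).trans_lt hx⟩
  obtain ⟨M₁, N₁, h₁⟩ := hX ((1 - x) / 3) (by linarith)
  obtain ⟨M₂, N₂, h₂⟩ := hX' ((1 - x) / 3) (by linarith)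
  filter_upwards [h (max 1 (max M₁ M₂)) (by positivity), eventually_ge_atTop N₁,
    eventually_ge_atTop N₂] with N hN hN₁ hN₂
  have hsub : (Set.univ : Set Ω) ⊆
      A N ∪ ({ω | M₁ * a N < |X N ω|} ∪ {ω | M₂ * a N < |X' N ω|}) := by
    intro ω _
    by_contra hω
    simp only [Set.mem_union, Set.mem_ofPred_eq, not_or, not_lt] at hω
    refine hω.1 (hN ω (hω.2.1.trans ?_) (hω.2.2.trans ?_))
    · exact mul_le_mul_of_nonneg_right ((le_max_left _ _).trans (le_max_right _ _)) (ha N)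
    · exact mul_le_mul_of_nonneg_right ((le_max_right _ _).trans (le_max_right _ _)) (ha N)
  have h3 := (measureReal_mono (μ := μ) hsub).trans ((measureReal_union_le _ _).trans
    (add_le_add_right (measureReal_union_le _ _) _))
  rw [probReal_univ] at h3
  have h4 := h₁ N hN₁
  have h5 := h₂ N hN₂
  change x < μ.real (A N)
  linarith

end LCA

theorem theorem1 {Ω : Type*} [MeasurableSpace Ω] (μ : Measure Ω) [IsProbabilityMeasure μ]
    {J K : ℕ} (νstar : Fin K → ℝ) (Bstar : Fin J → Fin K → ℝ)
    (ξ : ℕ → Ω → Fin K) (Y : ℕ → Fin J → Ω → Fin 2)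
    (hmodel : LCA.IsLatentClassModel μ νstar Bstar ξ Y)
    -- the true parameters are interior
    (hν : ∀ k, 0 < νstar k) (hB : ∀ j k, 0 < Bstar j k ∧ Bstar j k < 1)
    -- the unrestricted MLE, a function of the data, is root-N consistent
    (νhat : ∀ N, LCA.Data N J → Fin K → ℝ) (Bhat : ∀ N, LCA.Data N J → Fin J → Fin K → ℝ)
    (hMLE : ∀ N y, LCA.IsMLE y (νhat N y) (Bhat N y))
    (hνhat : LCA.IsBigOp μ
      (fun N ω => √(∑ k, (νhat N (LCA.sample Y N ω) k - νstar k) ^ 2))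
      (fun N => 1 / √(N : ℝ)))
    (hBhat : LCA.IsBigOp μ
      (fun N ω => √(∑ j, ∑ k, (Bhat N (LCA.sample Y N ω) j k - Bstar j k) ^ 2))
      (fun N => 1 / √(N : ℝ)))
    -- the EBIC constant
    (ρ : ℝ) (hρ : 0 < ρ)
    -- the stepwise search for each item, and the number of levels chosen by the EBIC
    (run : ∀ N (y : LCA.Data N J) (j : Fin J),
      LCA.StepwiseRun (LCA.pseudoLik y (LCA.posterior y (νhat N y) (Bhat N y)) j) (Bhat N y j))
    (mtilde : ∀ N, LCA.Data N J → Fin J → ℕ)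
    (hmtilde : ∀ N y j, LCA.IsEBICChoice N ρ
      (LCA.pseudoLik y (LCA.posterior y (νhat N y) (Bhat N y)) j) (run N y j).est (mtilde N y j))
    (j : Fin J) :
    Tendsto (fun N => μ {ω | mtilde N (LCA.sample Y N ω) j = LCA.numLevels (Bstar j)})
      atTop (𝓝 1) ∧
    (∀ g h : Fin K, Bstar j g = Bstar j h →
      Tendsto (fun N => μ {ω |
        (run N (LCA.sample Y N ω) j).est (mtilde N (LCA.sample Y N ω) j) g =
          (run N (LCA.sample Y N ω) j).est (mtilde N (LCA.sample Y N ω) j) h})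
        atTop (𝓝 1)) ∧
    (∀ g h : Fin K, Bstar j g ≠ Bstar j h →
      Tendsto (fun N => μ {ω |
        (run N (LCA.sample Y N ω) j).est (mtilde N (LCA.sample Y N ω) j) g ≠
          (run N (LCA.sample Y N ω) j).est (mtilde N (LCA.sample Y N ω) j) h})
        atTop (𝓝 1)) := by
  obtain ⟨c, hc, hcν, hcB, hsep⟩ := LCA.exists_margin hν hB
  -- All three events contain the same good event, so one argument serves them.
  have hmain : ∀ A : ℕ → Set Ω, (∀ N ω,
      (mtilde N (LCA.sample Y N ω) j = LCA.numLevels (Bstar j) ∧ ∀ g h,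
        (run N (LCA.sample Y N ω) j).est (mtilde N (LCA.sample Y N ω) j) g =
          (run N (LCA.sample Y N ω) j).est (mtilde N (LCA.sample Y N ω) j) h ↔
          Bstar j g = Bstar j h) → ω ∈ A N) →
      Tendsto (fun N => μ (A N)) atTop (𝓝 1) := by
    intro A hA
    refine LCA.tendsto_measure_one_of_isBigOp (fun N => by positivity) hνhat hBhat fun M hM => ?_
    have hr : ∀ᶠ N : ℕ in atTop, M * (1 / √(N : ℝ)) ≤ c / 8 := by
      have h1 : Tendsto (fun N : ℕ => M * (1 / √(N : ℝ))) atTop (𝓝 (M * 0)) := by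
        refine Tendsto.const_mul M ?_
        simp only [one_div]
        exact tendsto_inv_atTop_zero.comp
          (Real.tendsto_sqrt_atTop.comp tendsto_natCast_atTop_atTop)
      rw [mul_zero] at h1
      exact h1.eventually_le_const (by positivity)
    filter_upwards [eventually_gt_atTop 0, hr, LCA.eventually_penalty (2 * (16 * M ^ 2 / c ^ 2))
      (c ^ 3 / 64) (2 * Real.log ρ) K (by positivity)] with N hN hrN hpen ω hων hωB
    have hN' : (0 : ℝ) < N := by exact_mod_cast hN
    -- With `r = M / √N` the factor `N` cancels against `r^2`, so the loss `C` stays bounded.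
    have hC : (N : ℝ) * (16 * (M * (1 / √(N : ℝ))) ^ 2 / c ^ 2) = 16 * M ^ 2 / c ^ 2 := by
      rw [mul_pow, div_pow, Real.sq_sqrt hN'.le]
      field_simp
    rw [abs_of_nonneg (Real.sqrt_nonneg _)] at hων hωB
    refine hA N ω (LCA.selects_of_close (ρ := ρ) hN hc (by positivity) hrN hcν hcB (hsep j)
      (fun k => ?_) (fun j k => ?_) (hMLE N _) _ ?_ ?_ (hmtilde N _ j))
    · refine (Real.abs_le_sqrt ?_).trans hων
      exact Finset.single_le_sum
        (f := fun k => (νhat N (LCA.sample Y N ω) k - νstar k) ^ 2)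
        (fun _ _ => sq_nonneg _) (Finset.mem_univ k)
    · refine (Real.abs_le_sqrt ?_).trans hωB
      refine le_trans ?_ (Finset.single_le_sum
        (f := fun j => ∑ k, (Bhat N (LCA.sample Y N ω) j k - Bstar j k) ^ 2)
        (fun _ _ => Finset.sum_nonneg fun _ _ => sq_nonneg _) (Finset.mem_univ j))
      exact Finset.single_le_sum
        (f := fun k => (Bhat N (LCA.sample Y N ω) j k - Bstar j k) ^ 2)
        (fun _ _ => sq_nonneg _) (Finset.mem_univ k)
    · rw [hC]
      linarith [hpen.1]
    · rw [hC]
      exact hpen.2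
  exact ⟨hmain _ fun N ω h => h.1, fun g h hgh => hmain _ fun N ω H => (H.2 g h).2 hgh,
    fun g h hgh => hmain _ fun N ω H => fun he => hgh ((H.2 g h).1 he)⟩
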